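/- **Evolving model.** A network is a finite simple graph with at least one node. An evolving model with preferential node deletion is a Markov chain $(G_t)_{t\ge 0}$ of networks with an arbitrary initial law. At time $t$ a network $G$ with $n$ nodes grows with probability $p_{t,n}$ and decays with probability $1-p_{t,n}$, where $p_{t,1}=1$. When it grows, one node is added and joined to a random set $S$ of old nodes, whose law may depend on $t$ and $G$. When it decays, one node is deleted with its edges; node $v$ is chosen with probability $q_v(t)$, where $(q_v(t))_v$ is any probability distribution on the nodes of $G$, which may depend on $t$ and $G$ (for example, proportional to degree). With $N_k(G)$ the number of nodes of degree $k$ in $G$ and $N(G)$ the number of nodes, let $R_{(n,k)}(t)=\mathbb E\big[\mathbf 1_{N(G_t)=n}N_k(G_t)/N(G_t)\big]$, and let $P_k(t)=\mathbb E[N_k(G_t)/N(G_t)]$ be the average degree distribution obtained from the evolving rule. **Sample space of the extended stochastic process rule (ESPR).** A node is followed through an infinite population of networks; at time $0$ it is a uniformly chosen node of the initial network. Suppose it is the node $v$ of a network $G$ with $n$ nodes at time $t$. * Growth: with probability $\frac n{n+1}$ its network is kept and receives a new node by the attachment rule of $G$; with probability $\frac1{n+1}$ its network is dismantled, and $v$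 itself is attached by that rule as the new node of another copy of $G$. * Decay: a node $w$ is removed with probability $q_w(t)$. If $w\ne v$, then $v$ stays in $G-w$. If $w=v$, then $v$ is reinserted at a uniformly chosen place of a network $G-w'$, where $w'$ is drawn anew with probabilities $q_{w'}(t)$. Let $S_{(n,k)}(t)$ be the probability that the followed node has state $(n,k)$ at time $t$, i.e. lies in a network with $n$ nodes and has degree $k$. **ESPR state transition equation.** Let $\langle f\rangle_{(n,k)}$ denote the average of $f$ over the nodes in state $(n,k)$ in the sample space at time $t$, and let $N_v$ be the set of neighbours of $v$. Put $$q_{(n,k)}=\langle q_v\rangle_{(n,k)},\quad a_{(n,k)}=\Big\langle\sum_{w\ne v,\,w\notin N_v}q_w\Big\rangle_{(n,k)},\quad b_{(n,k)}=\Big\langle\sum_{w\in N_v}q_w\Big\rangle_{(n,k)},$$ $$c_{(n,k)}=\tfrac n{n+1}\langle \Pr(v\notin S)\rangle_{(n,k)},\quad d_{(n,k)}=\tfrac n{n+1}\langle \Pr(v\in S)\rangle_{(n,k)},\quad e_{(n,k),m}=\tfrac1{n+1}\langle \Pr(|S|=m)\rangle_{(n,k)},$$ all taken at time $t$. Let $EP_{(n,k)}(0)=S_{(n,k)}(0)$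 and, with $EP_{(n,k)}=EP_{(n,k)}(t)$ on the right-hand sides, set for decay $$P^*_{(n,k)(n-1,k')}=q_{(n,k)}\Big[\tfrac{(1-q_{(n,k')})EP_{(n,k')}}{\sum_j(1-q_{(n,j)})EP_{(n,j)}}\cdot\tfrac{a_{(n,k')}}{a_{(n,k')}+b_{(n,k')}}+\tfrac{(1-q_{(n,k'+1)})EP_{(n,k'+1)}}{\sum_j(1-q_{(n,j)})EP_{(n,j)}}\cdot\tfrac{b_{(n,k'+1)}}{a_{(n,k'+1)}+b_{(n,k'+1)}}\Big],$$ $$\begin{aligned}EP_{(n,k)}(t+1)={}&p_{t,n-1}\Big[EP_{(n-1,k)}c_{(n-1,k)}+EP_{(n-1,k-1)}d_{(n-1,k-1)}+\sum_jEP_{(n-1,j)}e_{(n-1,j),k}\Big]\\&+(1-p_{t,n+1})\Big[EP_{(n+1,k)}a_{(n+1,k)}+EP_{(n+1,k+1)}b_{(n+1,k+1)}+\sum_jEP_{(n+1,j)}P^*_{(n+1,j)(n,k)}\Big].\end{aligned}$$ Here $0/0=0$, and terms for networks with no nodes or for negative degrees are $0$. Let $EP_k(t)=\sum_nEP_{(n,k)}(t)$.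 **Theorem 1.** For every such model: 1. $S_{(n,k)}(t)=EP_{(n,k)}(t)=R_{(n,k)}(t)$ for all $t,n,k$; 2. $P_k(t)=EP_k(t)$ for all $t,k$; 3. for every $(p_k)_k$, $\lim_{t\to\infty}P_k(t)=p_k$ for all $k$ if and only if $\lim_{t\to\infty}EP_k(t)=p_k$ for all $k$; 4. if $P_k=\lim_{t\to\infty} P_k(t)$ and $EP_k=\lim_{t\to\infty} EP_k(t)$ exist for all $k$, then $P_k=EP_k$ for all $k$. -/

import Mathlib

open Filter Topology
open scoped ENNReal

/-- A network: a finite simple graph with at least one node, `⟨n, G⟩` having `n + 1` nodes. -/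
abbrev Net : Type := Σ n : ℕ, SimpleGraph (Fin (n + 1))

/-- A network together with one of its nodes. -/
abbrev NodeInNet : Type := Σ G : Net, Fin (G.1 + 1)

namespace Net

/-- The number of nodes. -/
def order (G : Net) : ℕ := G.1 + 1

/-- The degree of a node. -/
noncomputable def deg (G : Net) (v : Fin (G.1 + 1)) : ℕ := (G.2.neighborSet v).ncard

/-- The degree distribution of one network: `N_k / N`. -/
noncomputable def degreeFraction (G : Net) (k : ℕ) : ℝ≥0∞ :=
  ({v : Fin (G.1 + 1) | G.deg v = k}.ncard : ℝ≥0∞) / (G.order : ℝ≥0∞)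

/-- Delete the node `w` with all its edges. (On a one-node network the value is irrelevant:
deletion never happens there.) -/
def erase : (G : Net) → Fin (G.1 + 1) → Net
  | ⟨0, G⟩, _ => ⟨0, G⟩
  | ⟨n + 1, G⟩, w => ⟨n, G.comap w.succAbove⟩

/-- Add one node, joined to exactly the nodes of `S`. The new node is `Fin.last _`, the old node
`v` becomes `v.castSucc`. -/
def extend (G : Net) (S : Finset (Fin (G.1 + 1))) : Net :=
  ⟨G.1 + 1, G.2.map Fin.castSuccEmb ⊔
    SimpleGraph.fromRel (fun a b => a = Fin.last _ ∧ ∃ s ∈ S, b = Fin.castSucc s)⟩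

end Net

/-- The state `(n, k)` of a node: the scale of its network and its degree. -/
noncomputable def NodeInNet.state (x : NodeInNet) : ℕ × ℕ := (x.1.order, x.1.deg x.2)

/-- An evolving network model with (preferential) node deletion. At each time step a network with
`n` nodes gains a node (`true`) or loses one (`false`). The node to be deleted is drawn from a law
that may depend in any way on the present network, e.g. proportionally to the degrees. -/
structure EvolvingModel where
  /-- The law of the initial network; a fixed network `G₀` is `PMF.pure G₀`. -/
  init : PMF Net
  /-- Growth (`true`) or decay (`false`) at time `t` for a network with `n` nodes. -/
  op : (t n : ℕ) → PMF Bool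
  /-- The last remaining node is never deleted. -/
  op_one : ∀ t, op t 1 false = 0
  /-- The law of the set of old nodes to which a newly added node is joined. -/
  attach : (t : ℕ) → (G : Net) → PMF (Finset (Fin (G.1 + 1)))
  /-- The law of the deleted node: `remove t G v` is the removal probability `q_v(t)`. -/
  remove : (t : ℕ) → (G : Net) → PMF (Fin (G.1 + 1))

namespace EvolvingModel

variable (M : EvolvingModel)

/-! ### The evolving rule itself -/

/-- One step of the evolving rule. -/
noncomputable def ruleStep (t : ℕ) (G : Net) : PMF Net :=
  (M.op t G.order).bind fun b =>
    if b then (M.attach t G).map G.extend else (M.remove t G).map G.erase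

/-- The law of the network `G(t)` of the graph process. -/
noncomputable def law : ℕ → PMF Net
  | 0 => M.init
  | t + 1 => (law t).bind (M.ruleStep t)

open Classical in
/-- The probability that `G(t)` has `n` nodes and that a uniformly chosen one of them has
degree `k`. -/
noncomputable def ruleState (t n k : ℕ) : ℝ≥0∞ :=
  ∑' G : Net, if G.order = n then M.law t G * G.degreeFraction k else 0

/-- The average degree distribution `P_k(t)` of the graph process. -/
noncomputable def ruleDegree (t k : ℕ) : ℝ≥0∞ :=
  ∑' G : Net, M.law t G * G.degreeFraction k

/-! ### The sample space of the extended stochastic process rule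

The networks at time `t` form an infinite population; `sample t` is the law of (the network and the
position of) a node followed through this population. Nodes are never lost: a node that is isolated
by the rule is reinserted into a network that is present at time `t + 1`. -/

open Classical in
/-- Addition. Of `n + 1` networks with the same topology one (number `i`) is dismantled, and
its `n` nodes are attached as new nodes to the `n` others. The followed node sits in network
number `0`. -/
noncomputable def sampleGrow (t : ℕ) (x : NodeInNet) : PMF NodeInNet :=
  (PMF.uniformOfFintype (Fin (x.1.order + 1))).bind fun i =>
    (M.attach t x.1).map fun S =>
      if i = 0 then (⟨x.1.extend S, Fin.last _⟩ : NodeInNet)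
      else (⟨x.1.extend S, Fin.castSucc x.2⟩ : NodeInNet)

open Classical in
/-- Deletion. In many copies of a network `G` a node is removed according to the removal
probabilities; the remaining networks form the set `A(t)`. If the followed node `v` survives, it
stays in its network. If `v` itself is removed, it is converted to a node type with the
frequencies of the types in `A(t)` and reinserted into a copy of a network of `A(t)`, that is,
it takes a uniformly chosen place in a random network of `A(t)`. -/
noncomputable def sampleDecay (t : ℕ) : NodeInNet → PMF NodeInNet
  | ⟨⟨0, G⟩, v⟩ => PMF.pure ⟨⟨0, G⟩, v⟩
  | ⟨⟨n + 1, G⟩, v⟩ =>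
      (M.remove t ⟨n + 1, G⟩).bind fun w =>
        if h : v ≠ w then
          PMF.pure ⟨⟨n, G.comap w.succAbove⟩, (finSuccAboveEquiv w).symm ⟨v, h⟩⟩
        else
          (M.remove t ⟨n + 1, G⟩).bind fun w' =>
            (PMF.uniformOfFintype (Fin (n + 1))).map fun u => ⟨⟨n, G.comap w'.succAbove⟩, u⟩

/-- The law of the followed node: at time `0` it is a uniformly chosen node of the initial
network. -/
noncomputable def sample : ℕ → PMF NodeInNet
  | 0 => M.init.bind fun G =>
      (PMF.uniformOfFintype (Fin (G.1 + 1))).map fun v => (⟨G, v⟩ : NodeInNet)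
  | t + 1 => (sample t).bind fun x =>
      (M.op t x.1.order).bind fun b => if b then M.sampleGrow t x else M.sampleDecay t x

open Classical in
/-- The proportion of nodes in state `(n, k)` in the sample space at time `t`. -/
noncomputable def sampleState (t n k : ℕ) : ℝ≥0∞ :=
  ∑' x : NodeInNet, if x.state = (n, k) then M.sample t x else 0

/-! ### One-step state transition probabilities and the state transition equation -/

open Classical in
/-- The average of `f` over the nodes in state `(n, k)` in the sample space at time `t`. -/
noncomputable def stateAvg (t n k : ℕ) (f : NodeInNet → ℝ≥0∞) : ℝ≥0∞ :=
  (∑' x : NodeInNet, if x.state = (n, k) then M.sample t x * f x else 0) / M.sampleState t n k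

/-- Removal probability `q_{(n,k)}(t)` of a node in state `(n, k)`. -/
noncomputable def qState (t n k : ℕ) : ℝ≥0∞ :=
  M.stateAvg t n k fun x => M.remove t x.1 x.2

open Classical in
/-- `P_{(n,k)(n-1,k)}(t) = ∑_{w ∉ N_v} q_w(t)`: a node other than `v` and its neighbours is
removed. -/
noncomputable def decayStay (t n k : ℕ) : ℝ≥0∞ :=
  M.stateAvg t n k fun x =>
    ∑ w, if w ≠ x.2 ∧ ¬ x.1.2.Adj x.2 w then M.remove t x.1 w else 0

open Classical in
/-- `P_{(n,k)(n-1,k-1)}(t) = ∑_{w ∈ N_v} q_w(t)`: a neighbour of `v` is removed. -/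
noncomputable def decayDrop (t n k : ℕ) : ℝ≥0∞ :=
  M.stateAvg t n k fun x => ∑ w, if x.1.2.Adj x.2 w then M.remove t x.1 w else 0

/-- `P*_{(n,k)(n-1,k')}(t)` for a node that is itself removed, given the state probabilities
`P n j = P_{(n,j)}(t)`. -/
noncomputable def decayIsolated (P : ℕ → ℕ → ℝ≥0∞) (t n k k' : ℕ) : ℝ≥0∞ :=
  M.qState t n k *
    ((1 - M.qState t n k') * P n k' / (∑' j, P n j * (1 - M.qState t n j)) *
        (M.decayStay t n k' / (M.decayStay t n k' + M.decayDrop t n k')) +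
      (1 - M.qState t n (k' + 1)) * P n (k' + 1) / (∑' j, P n j * (1 - M.qState t n j)) *
        (M.decayDrop t n (k' + 1) / (M.decayStay t n (k' + 1) + M.decayDrop t n (k' + 1))))

open Classical in
/-- `P_{(n,k)(n+1,k)}(t)`, given growth: the network is not dismantled, the new node is not
joined to `v`. -/
noncomputable def growStay (t n k : ℕ) : ℝ≥0∞ :=
  (n : ℝ≥0∞) / (n + 1) *
    M.stateAvg t n k fun x => ∑ S, if x.2 ∉ S then M.attach t x.1 S else 0

open Classical in
/-- `P_{(n,k)(n+1,k+1)}(t)`, given growth: the network is not dismantled, the new node is joined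
to `v`. -/
noncomputable def growUp (t n k : ℕ) : ℝ≥0∞ :=
  (n : ℝ≥0∞) / (n + 1) *
    M.stateAvg t n k fun x => ∑ S, if x.2 ∈ S then M.attach t x.1 S else 0

open Classical in
/-- `P_{(n,k)(n+1,m)}(t)`, given growth, for a node that is attached as a new node, with
`m` edges. -/
noncomputable def growNew (t n k m : ℕ) : ℝ≥0∞ :=
  1 / ((n : ℝ≥0∞) + 1) *
    M.stateAvg t n k fun x => ∑ S, if S.card = m then M.attach t x.1 S else 0

/-- The part of the state transition equation that comes from networks that grow from
`n - 1` to `n` nodes. -/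
noncomputable def growPart (P : ℕ → ℕ → ℝ≥0∞) (t : ℕ) : (n k : ℕ) → ℝ≥0∞
  | 0, _ => 0
  | n + 1, 0 => M.op t n true *
      (P n 0 * M.growStay t n 0 + ∑' j, P n j * M.growNew t n j 0)
  | n + 1, k + 1 => M.op t n true *
      (P n (k + 1) * M.growStay t n (k + 1) + P n k * M.growUp t n k +
        ∑' j, P n j * M.growNew t n j (k + 1))

/-- The part of the state transition equation that comes from networks that decay from
`n + 1` to `n` nodes. -/
noncomputable def decayPart (P : ℕ → ℕ → ℝ≥0∞) (t n k : ℕ) : ℝ≥0∞ :=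
  M.op t (n + 1) false *
    (P (n + 1) k * M.decayStay t (n + 1) k +
      P (n + 1) (k + 1) * M.decayDrop t (n + 1) (k + 1) +
      ∑' j, P (n + 1) j * M.decayIsolated P t (n + 1) j k)

/-- The state probabilities `P_{(n,k)}(t)` obtained from the extended stochastic process rule, i.e.
by iterating the state transition equation. -/
noncomputable def esprState : ℕ → ℕ → ℕ → ℝ≥0∞
  | 0, n, k => M.sampleState 0 n k
  | t + 1, n, k => M.growPart (esprState t) t n k + M.decayPart (esprState t) t n k

/-- The degree distribution at time `t` obtained from the extended stochastic process rule. -/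
noncomputable def esprDegree (t k : ℕ) : ℝ≥0∞ := ∑' n, M.esprState t n k

end EvolvingModel

/-- `p` is the steady-state distribution of the time-dependent distributions `P t`. -/
def IsSteady (P : ℕ → ℕ → ℝ≥0∞) (p : ℕ → ℝ≥0∞) : Prop :=
  ∀ k, Tendsto (fun t => P t k) atTop (𝓝 (p k))

/-! The key fact is `sample_eq`: at every time the followed node is a uniformly chosen node of
`G_t`. Growth preserves uniformity because the new node and each of the `n` old ones get weight
`1/(n+1)`. Decay preserves it because a removed node is reinserted with exactly the law one wants
for the survivors.

Hence each product `S_(n,k) * ⟨f⟩_(n,k)` is an expectation over `G_t`, and the state transition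
equation evaluated at `S` can be compared with one step of the evolving rule (`esprState_step`). The
growth terms count the nodes of the enlarged network by degree. For decay from `n + 1` nodes,
survivors supply the share `n/(n+1)` of the expected degree fraction. The nonlinear term `P*`
supplies the remaining `1/(n+1)`, since a uniform node is the removed one with probability
`1/(n+1)`. Induction on `t` gives `EP = R`; summing over `n` gives `P_k = EP_k`, and the claims on
limits follow. -/

namespace PMF

/-! ### Expectations under a probability mass function. -/

variable {α β : Type*}

/-- The mean of a nonnegative function under a probability mass function. -/
noncomputable def mean (p : PMF α) (f : α → ℝ≥0∞) : ℝ≥0∞ := ∑' x, p x * f x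

theorem mean_pure (a : α) (f : α → ℝ≥0∞) : (PMF.pure a).mean f = f a := by
  classical
  rw [mean, tsum_eq_single a]
  · simp
  · intro b hb
    simp [PMF.pure_apply, hb]

theorem mean_bind (p : PMF α) (g : α → PMF β) (f : β → ℝ≥0∞) :
    (p.bind g).mean f = p.mean fun x => (g x).mean f := by
  simp only [mean, PMF.bind_apply, ← ENNReal.tsum_mul_right, ← ENNReal.tsum_mul_left]
  rw [ENNReal.tsum_comm]
  simp only [mul_assoc]

theorem mean_map (p : PMF α) (g : α → β) (f : β → ℝ≥0∞) :
    (p.map g).mean f = p.mean fun x => f (g x) := by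
  simp only [PMF.map, mean_bind, Function.comp_apply, mean_pure]

theorem mean_uniform [Fintype α] [Nonempty α] (f : α → ℝ≥0∞) :
    (PMF.uniformOfFintype α).mean f = (∑ x, f x) / Fintype.card α := by
  simp only [mean, PMF.uniformOfFintype_apply, tsum_fintype, ← Finset.mul_sum]
  rw [mul_comm, div_eq_mul_inv]

theorem mean_fintype [Fintype α] (p : PMF α) (f : α → ℝ≥0∞) :
    p.mean f = ∑ x, p x * f x := tsum_fintype _

theorem mean_bool (p : PMF Bool) (f : Bool → ℝ≥0∞) :
    p.mean f = p true * f true + p false * f false := by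
  simp [mean, tsum_fintype]

theorem mean_const (p : PMF α) (c : ℝ≥0∞) : (p.mean fun _ => c) = c := by
  simp [mean, ENNReal.tsum_mul_right]

theorem mean_add (p : PMF α) (f g : α → ℝ≥0∞) :
    (p.mean fun x => f x + g x) = p.mean f + p.mean g := by
  simp only [mean, mul_add, ENNReal.tsum_add]

theorem mean_const_mul (p : PMF α) (c : ℝ≥0∞) (f : α → ℝ≥0∞) :
    (p.mean fun x => c * f x) = c * p.mean f := by
  simp only [mean, ← ENNReal.tsum_mul_left, mul_left_comm]

theorem mean_tsum {ι : Type*} (p : PMF α) (f : ι → α → ℝ≥0∞) :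
    (p.mean fun x => ∑' i, f i x) = ∑' i, p.mean (f i) := by
  simp only [mean, ← ENNReal.tsum_mul_left]
  rw [ENNReal.tsum_comm]

theorem mean_mono (p : PMF α) {f g : α → ℝ≥0∞} (h : ∀ x, f x ≤ g x) : p.mean f ≤ p.mean g :=
  ENNReal.tsum_le_tsum fun x => mul_le_mul_right (h x) _

theorem ext_mean {p q : PMF α} (h : ∀ f, p.mean f = q.mean f) : p = q := by
  classical
  ext a
  simpa [mean, mul_ite] using h fun x => if x = a then 1 else 0

end PMF

/-! ### Degrees after adding or deleting a node. -/

namespace Net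

variable (G : Net)

theorem order_eq : (G.order : ℝ≥0∞) = (G.1 : ℝ≥0∞) + 1 := by simp [order]

theorem order_ne_zero : (G.order : ℝ≥0∞) ≠ 0 := by simp [order]

theorem order_extend (S : Finset (Fin (G.1 + 1))) : (G.extend S).order = G.order + 1 := rfl

/-- The graph with one more node `Fin.last _`, joined to exactly the nodes of `S`. -/
def extendGraph {n : ℕ} (G : SimpleGraph (Fin n)) (S : Finset (Fin n)) :
    SimpleGraph (Fin (n + 1)) :=
  G.map Fin.castSuccEmb ⊔
    SimpleGraph.fromRel (fun a b => a = Fin.last _ ∧ ∃ s ∈ S, b = Fin.castSucc s)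

section extendGraph

variable {n : ℕ} (H : SimpleGraph (Fin n)) (S : Finset (Fin n))

theorem extendGraph_adj_castSucc (u v : Fin n) :
    (extendGraph H S).Adj u.castSucc v.castSucc ↔ H.Adj u v := by
  rw [extendGraph, SimpleGraph.sup_adj, SimpleGraph.fromRel_adj]
  have h := SimpleGraph.map_adj_apply (G := H) (f := Fin.castSuccEmb) (a := u) (b := v)
  rw [Fin.coe_castSuccEmb] at *
  rw [h]
  simp [(Fin.castSucc_lt_last _).ne]

theorem extendGraph_adj_last (v : Fin n) :
    (extendGraph H S).Adj (Fin.last _) v.castSucc ↔ v ∈ S := by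
  rw [extendGraph, SimpleGraph.sup_adj, SimpleGraph.fromRel_adj, SimpleGraph.map_adj]
  simp [(Fin.castSucc_lt_last _).ne, (Fin.castSucc_lt_last _).ne']

theorem ncard_neighborSet_extendGraph_last :
    ((extendGraph H S).neighborSet (Fin.last _)).ncard = S.card := by
  have h : (extendGraph H S).neighborSet (Fin.last _) = Fin.castSucc '' (S : Set (Fin n)) := by
    ext x
    induction x using Fin.lastCases with
    | last => simp [(Fin.castSucc_lt_last _).ne]
    | cast v => simpa using extendGraph_adj_last H S v
  rw [h, Set.ncard_image_of_injective _ (Fin.castSucc_injective _), Set.ncard_coe_finset]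

open Classical in
theorem ncard_neighborSet_extendGraph_castSucc (v : Fin n) :
    ((extendGraph H S).neighborSet v.castSucc).ncard =
      (H.neighborSet v).ncard + if v ∈ S then 1 else 0 := by
  have h : (extendGraph H S).neighborSet v.castSucc =
      (if v ∈ S then {Fin.last _} else ∅) ∪ Fin.castSucc '' H.neighborSet v := by
    ext x
    induction x using Fin.lastCases with
    | last =>
      have := extendGraph_adj_last H S v
      rw [SimpleGraph.adj_comm] at this
      by_cases hv : v ∈ S <;> simp [hv, this, (Fin.castSucc_lt_last _).ne]
    | cast u =>
      have := extendGraph_adj_castSucc H S v u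
      by_cases hv : v ∈ S <;> simp [hv, this, (Fin.castSucc_lt_last _).ne]
  rw [h, Set.ncard_union_eq _ (Set.toFinite _) (Set.toFinite _),
    Set.ncard_image_of_injective _ (Fin.castSucc_injective _), add_comm]
  · by_cases hv : v ∈ S <;> simp [hv]
  · by_cases hv : v ∈ S <;> simp [hv, (Fin.castSucc_lt_last _).ne]

end extendGraph

/-- `Net.extend` unfolds definitionally to `extendGraph`, which keeps the graph arguments free of
sigma types. -/
theorem deg_extend_last (S : Finset (Fin (G.1 + 1))) :
    (G.extend S).deg (Fin.last (G.1 + 1)) = S.card :=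
  ncard_neighborSet_extendGraph_last G.2 S

open Classical in
theorem deg_extend_castSucc (S : Finset (Fin (G.1 + 1))) (v : Fin (G.1 + 1)) :
    (G.extend S).deg (Fin.castSucc v : Fin (G.1 + 1 + 1)) = G.deg v + if v ∈ S then 1 else 0 :=
  ncard_neighborSet_extendGraph_castSucc G.2 S v

theorem sum_extend (S : Finset (Fin (G.1 + 1))) (φ : Fin (G.1 + 1 + 1) → ℝ≥0∞) :
    (∑ v : Fin ((G.extend S).1 + 1), φ v) =
      ∑ v : Fin (G.1 + 1), φ v.castSucc + φ (Fin.last _) :=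
  Fin.sum_univ_castSucc φ

open Classical in
theorem deg_succAbove {n : ℕ} (G : SimpleGraph (Fin (n + 2))) (w : Fin (n + 2)) (u : Fin (n + 1)) :
    deg ⟨n + 1, G⟩ (w.succAbove u) = deg ⟨n, G.comap w.succAbove⟩ u +
      if G.Adj (w.succAbove u) w then 1 else 0 := by
  have h : G.neighborSet (w.succAbove u) = (if G.Adj (w.succAbove u) w then {w} else ∅) ∪
      w.succAbove '' (G.comap w.succAbove).neighborSet u := by
    ext x
    rcases Fin.eq_self_or_eq_succAbove w x with rfl | ⟨y, rfl⟩
    · by_cases hx : G.Adj (x.succAbove u) x <;> simp [hx, Fin.succAbove_ne]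
    · by_cases hx : G.Adj (w.succAbove u) w <;> simp [hx, Fin.succAbove_ne]
  simp only [deg]
  rw [h, Set.ncard_union_eq _ (Set.toFinite _) (Set.toFinite _),
    Set.ncard_image_of_injective _ Fin.succAbove_right_injective, add_comm]
  · by_cases hv : G.Adj (w.succAbove u) w <;> simp [hv]
  · by_cases hv : G.Adj (w.succAbove u) w <;> simp [hv, Fin.succAbove_ne]

open Classical in
theorem degreeFraction_eq (k : ℕ) :
    G.degreeFraction k = (∑ v, if G.deg v = k then 1 else 0) / (G.order : ℝ≥0∞) := by
  rw [degreeFraction, Set.ncard_eq_toFinset_card']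
  simp

end Net

/-! ### Uniformity of the followed node. -/

namespace EvolvingModel

variable (M : EvolvingModel)

/-- A network together with a uniformly chosen node. -/
noncomputable def uniformNode (G : Net) : PMF NodeInNet :=
  (PMF.uniformOfFintype (Fin (G.1 + 1))).map fun v => (⟨G, v⟩ : NodeInNet)

theorem mean_uniformNode (G : Net) (f : NodeInNet → ℝ≥0∞) :
    (uniformNode G).mean f = (∑ v, f ⟨G, v⟩) / (G.order : ℝ≥0∞) := by
  rw [uniformNode, PMF.mean_map, PMF.mean_uniform, Fintype.card_fin, Net.order]

theorem mean_sampleGrow (t : ℕ) (x : NodeInNet) (f : NodeInNet → ℝ≥0∞) :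
    (M.sampleGrow t x).mean f =
      (M.attach t x.1).mean fun S =>
        (f ⟨x.1.extend S, Fin.last _⟩ + x.1.order * f ⟨x.1.extend S, Fin.castSucc x.2⟩) /
          (x.1.order + 1) := by
  simp only [sampleGrow, PMF.mean_bind, PMF.mean_map, PMF.mean_uniform, Fintype.card_fin,
    Fin.sum_univ_succ, if_true, Fin.succ_ne_zero, if_false, Finset.sum_const, Finset.card_univ,
    nsmul_eq_mul, div_eq_mul_inv, ← PMF.mean_const_mul, ← PMF.mean_add]
  rw [mul_comm, ← PMF.mean_const_mul]
  push_cast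
  simp only [mul_comm]

theorem mean_uniformNode_sampleGrow (t : ℕ) (G : Net) (f : NodeInNet → ℝ≥0∞) :
    ((uniformNode G).mean fun x => (M.sampleGrow t x).mean f) =
      (M.attach t G).mean fun S => (uniformNode (G.extend S)).mean f := by
  rw [mean_uniformNode]
  simp only [mean_sampleGrow, mean_uniformNode, PMF.mean_fintype]
  rw [Finset.sum_comm, div_eq_mul_inv, Finset.sum_mul]
  refine Finset.sum_congr rfl fun S _ => ?_
  rw [← Finset.mul_sum, mul_assoc]
  congr 1
  rw [Net.sum_extend G S fun v => f ⟨G.extend S, v⟩, Net.order_extend, Nat.cast_add, Nat.cast_one]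
  simp only [div_eq_mul_inv, ← Finset.sum_mul]
  rw [mul_right_comm]
  congr 1
  rw [Finset.sum_add_distrib, ← Finset.mul_sum, Finset.sum_const, Finset.card_univ,
    Fintype.card_fin, nsmul_eq_mul]
  change ((G.order : ℝ≥0∞) * _ + _) * _ = _
  -- The `n` copies that are kept cancel the `1/n` of the uniform choice.
  rw [← mul_add, mul_right_comm,
    ENNReal.mul_inv_cancel G.order_ne_zero (ENNReal.natCast_ne_top _), one_mul, add_comm]
  rfl

/-- Let `K` be the right-hand side. A removed node is reinserted with a law of mean `K`, whatever
`w` was. For fixed `w`, the `n + 1` survivors are exactly the nodes of `G - w`. Summed over `v` and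
averaged over `w` this gives `K + (n + 1) K`, that is, `n + 2` times `K`. -/
theorem mean_uniformNode_sampleDecay (t n : ℕ) (G : SimpleGraph (Fin (n + 2)))
    (f : NodeInNet → ℝ≥0∞) :
    ((uniformNode ⟨n + 1, G⟩).mean fun x => (M.sampleDecay t x).mean f) =
      (M.remove t ⟨n + 1, G⟩).mean fun w =>
        (uniformNode ⟨n, G.comap w.succAbove⟩).mean f := by
  set K := (M.remove t ⟨n + 1, G⟩).mean fun w =>
        (uniformNode ⟨n, G.comap w.succAbove⟩).mean f with hK
  have hd (v : Fin (n + 2)) : (M.sampleDecay t ⟨⟨n + 1, G⟩, v⟩).mean f =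
      (M.remove t ⟨n + 1, G⟩).mean fun w => if h : v ≠ w then
        f ⟨⟨n, G.comap w.succAbove⟩, (finSuccAboveEquiv w).symm ⟨v, h⟩⟩ else K := by
    rw [sampleDecay, PMF.mean_bind]
    congr 1
    funext w
    by_cases h : v ≠ w
    · simp only [dif_pos h, PMF.mean_pure]
    · simp only [dif_neg h, PMF.mean_bind, hK]
      rfl
  rw [mean_uniformNode]
  simp only [hd]
  have hs (w : Fin (n + 2)) : (∑ v, if h : v ≠ w then
        f ⟨⟨n, G.comap w.succAbove⟩, (finSuccAboveEquiv w).symm ⟨v, h⟩⟩ else K) =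
      K + ((n : ℝ≥0∞) + 1) * (uniformNode ⟨n, G.comap w.succAbove⟩).mean f := by
    rw [Fin.sum_univ_succAbove _ w, mean_uniformNode, Net.order_eq, ENNReal.mul_div_cancel
      (by simp) (by simp)]
    congr 1
    · simp
    · refine Finset.sum_congr rfl fun u _ => ?_
      rw [dif_pos (Fin.succAbove_ne w u)]
      congr 2
      exact (finSuccAboveEquiv w).symm_apply_apply u
  simp only [PMF.mean_fintype (M.remove t _)]
  rw [Finset.sum_comm]
  simp only [← Finset.mul_sum, hs]
  rw [← PMF.mean_fintype (M.remove t ⟨n + 1, G⟩), PMF.mean_add, PMF.mean_const, PMF.mean_const_mul,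
    ← hK, Net.order_eq]
  push_cast
  rw [show K + ((n : ℝ≥0∞) + 1) * K = ((n : ℝ≥0∞) + 1 + 1) * K by ring, mul_div_assoc,
    ENNReal.mul_div_cancel (by simp) (by finiteness)]

/-- The followed node is a uniformly chosen node of the network of the graph process. -/
theorem sample_eq (t : ℕ) : M.sample t = (M.law t).bind uniformNode := by
  induction t with
  | zero => rfl
  | succ t ih =>
    refine PMF.ext_mean fun f => ?_
    rw [sample, ih, law]
    simp only [PMF.mean_bind]
    congr 1
    funext G
    rw [ruleStep, PMF.mean_bind, PMF.mean_bool]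
    simp only [PMF.mean_bool, if_true, Bool.false_eq_true, if_false, PMF.mean_map]
    rw [← mean_uniformNode_sampleGrow]
    -- The growth probability depends only on the order, which all nodes of `G` share.
    have hx : ∀ g h : NodeInNet → ℝ≥0∞, ((uniformNode G).mean fun x =>
        M.op t x.1.order true * g x + M.op t x.1.order false * h x) =
        M.op t G.order true * (uniformNode G).mean g +
          M.op t G.order false * (uniformNode G).mean h := by
      intro g h
      rw [mean_uniformNode]
      simp only [← PMF.mean_const_mul, ← PMF.mean_add]
      rw [mean_uniformNode]
    rw [hx]
    congr 1
    obtain ⟨n, G⟩ := G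
    cases n with
    | zero => simp [Net.order, M.op_one]
    | succ n => rw [mean_uniformNode_sampleDecay]; rfl

end EvolvingModel

/-! ### State probabilities and state averages as expectations over the graph process. -/

namespace EvolvingModel

variable (M : EvolvingModel)

theorem state_mk_eq_iff (G : Net) (v : Fin (G.1 + 1)) (n k : ℕ) :
    NodeInNet.state ⟨G, v⟩ = (n, k) ↔ G.order = n ∧ G.deg v = k := by
  simp [NodeInNet.state]

open Classical in
theorem mean_sample_state (t n k : ℕ) (f : NodeInNet → ℝ≥0∞) :
    ((M.sample t).mean fun x => if x.state = (n, k) then f x else 0) =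
      (M.law t).mean fun G => if G.order = n then
        (∑ v, if G.deg v = k then f ⟨G, v⟩ else 0) / (n : ℝ≥0∞) else 0 := by
  rw [sample_eq, PMF.mean_bind]
  congr 1
  funext G
  rw [mean_uniformNode]
  simp only [state_mk_eq_iff]
  split_ifs with h
  · simp [h]
  · simp [h]

open Classical in
theorem sampleState_eq_mean (t n k : ℕ) :
    M.sampleState t n k = (M.sample t).mean fun x => if x.state = (n, k) then 1 else 0 := by
  simp [sampleState, PMF.mean]

theorem sampleState_le_one (t n k : ℕ) : M.sampleState t n k ≤ 1 := by
  classical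
  rw [sampleState_eq_mean]
  refine (PMF.mean_mono _ (g := fun _ => 1) fun x => ?_).trans_eq (PMF.mean_const _ 1)
  split_ifs <;> simp

theorem sampleState_ne_top (t n k : ℕ) : M.sampleState t n k ≠ ∞ :=
  ((M.sampleState_le_one t n k).trans_lt ENNReal.one_lt_top).ne

open Classical in
theorem ruleState_eq_mean (t n k : ℕ) :
    M.ruleState t n k =
      (M.law t).mean fun G => if G.order = n then G.degreeFraction k else 0 := by
  simp [ruleState, PMF.mean]

theorem sampleState_eq_ruleState (t n k : ℕ) : M.sampleState t n k = M.ruleState t n k := by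
  classical
  rw [sampleState_eq_mean, mean_sample_state, ruleState_eq_mean]
  congr 1
  funext G
  split_ifs with h
  · rw [Net.degreeFraction_eq, h]
  · rfl

-- Multiplying by the state probability undoes the normalisation of the average. For a state of
-- probability zero both sides vanish, so the convention `0/0 = 0` is harmless.
open Classical in
theorem sampleState_mul_stateAvg (t n k : ℕ) (f : NodeInNet → ℝ≥0∞) :
    M.sampleState t n k * M.stateAvg t n k f =
      (M.law t).mean fun G => if G.order = n then
        (∑ v, if G.deg v = k then f ⟨G, v⟩ else 0) / (n : ℝ≥0∞) else 0 := by
  rw [← mean_sample_state, stateAvg]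
  have h : (∑' x : NodeInNet, if x.state = (n, k) then M.sample t x * f x else 0) =
      (M.sample t).mean fun x => if x.state = (n, k) then f x else 0 := by
    simp [PMF.mean]
  rw [h]
  by_cases h0 : M.sampleState t n k = 0
  · rw [h0, zero_mul, eq_comm, PMF.mean, ENNReal.tsum_eq_zero]
    intro x
    rw [sampleState, ENNReal.tsum_eq_zero] at h0
    have := h0 x
    split_ifs with hx
    · rw [if_pos hx] at this
      rw [this, zero_mul]
    · rw [mul_zero]
  · exact ENNReal.mul_div_cancel h0 (M.sampleState_ne_top t n k)

theorem tsum_sampleState_mul_stateAvg (t n : ℕ) (f : NodeInNet → ℝ≥0∞) :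
    ∑' k, M.sampleState t n k * M.stateAvg t n k f =
      (M.law t).mean fun G => if G.order = n then (∑ v, f ⟨G, v⟩) / (n : ℝ≥0∞) else 0 := by
  classical
  simp only [sampleState_mul_stateAvg]
  rw [← PMF.mean_tsum]
  congr 1
  funext G
  split_ifs with h
  · simp only [div_eq_mul_inv, ENNReal.tsum_mul_right]
    congr 1
    rw [Summable.tsum_finsetSum fun _ _ => ENNReal.summable]
    simp
  · simp

/-! ### Growth -/

-- The factor `n/(n+1)` turns the normalisation by the old order into one by the order of the grown
-- network.
open Classical in
theorem sampleState_mul_growStay (t n k : ℕ) :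
    M.sampleState t n k * M.growStay t n k =
      (M.law t).mean fun G => if G.order = n then
        (∑ v, if G.deg v = k then ∑ S, if v ∉ S then M.attach t G S else 0 else 0) /
          ((n : ℝ≥0∞) + 1) else 0 := by
  rw [growStay, mul_left_comm, sampleState_mul_stateAvg, ← PMF.mean_const_mul]
  congr 1
  funext G
  split_ifs with h
  · rw [mul_comm, ← mul_div_assoc,
      ENNReal.div_mul_cancel (h ▸ G.order_ne_zero) (ENNReal.natCast_ne_top _)]
  · rw [mul_zero]

open Classical in
theorem sampleState_mul_growUp (t n k : ℕ) :
    M.sampleState t n k * M.growUp t n k =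
      (M.law t).mean fun G => if G.order = n then
        (∑ v, if G.deg v = k then ∑ S, if v ∈ S then M.attach t G S else 0 else 0) /
          ((n : ℝ≥0∞) + 1) else 0 := by
  rw [growUp, mul_left_comm, sampleState_mul_stateAvg, ← PMF.mean_const_mul]
  congr 1
  funext G
  split_ifs with h
  · rw [mul_comm, ← mul_div_assoc,
      ENNReal.div_mul_cancel (h ▸ G.order_ne_zero) (ENNReal.natCast_ne_top _)]
  · rw [mul_zero]

-- The law of `|S|` does not depend on the followed node, so summing over the `n` nodes cancels
-- `1/n`.
open Classical in
theorem tsum_sampleState_mul_growNew (t n m : ℕ) :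
    ∑' j, M.sampleState t n j * M.growNew t n j m =
      (M.law t).mean fun G => if G.order = n then
        (∑ S, if S.card = m then M.attach t G S else 0) / ((n : ℝ≥0∞) + 1) else 0 := by
  simp only [growNew, mul_left_comm (M.sampleState t n _)]
  rw [ENNReal.tsum_mul_left, tsum_sampleState_mul_stateAvg, ← PMF.mean_const_mul]
  congr 1
  funext G
  split_ifs with h
  · change 1 / ((n : ℝ≥0∞) + 1) * ((∑ _v : Fin (G.1 + 1), ∑ S : Finset (Fin (G.1 + 1)),
      if S.card = m then M.attach t G S else 0) / (n : ℝ≥0∞)) = _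
    rw [Finset.sum_const, Finset.card_univ, Fintype.card_fin, nsmul_eq_mul,
      show ((G.1 + 1 : ℕ) : ℝ≥0∞) = n from congrArg Nat.cast h, mul_comm (n : ℝ≥0∞), ENNReal.mul_div_cancel_right
      (h ▸ G.order_ne_zero) (ENNReal.natCast_ne_top _), one_div, div_eq_mul_inv, mul_comm]
  · rw [mul_zero]

open Classical in
theorem degreeFraction_extend (G : Net) (S : Finset (Fin (G.1 + 1))) (k : ℕ) :
    (G.extend S).degreeFraction k =
      ((∑ v, if G.deg v + (if v ∈ S then 1 else 0) = k then 1 else 0) +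
        if S.card = k then 1 else 0) / ((G.order : ℝ≥0∞) + 1) := by
  rw [Net.degreeFraction_eq,
    Net.sum_extend G S fun v => if (G.extend S).deg v = k then 1 else 0]
  simp only [Net.deg_extend_castSucc, Net.deg_extend_last]
  simp [Net.order_extend]

/-- A node of degree `k` in the grown network is an old one of degree `k` outside `S`, an old one of
degree `k - 1` in `S`, or the new one with `|S| = k`: the three terms of `growPart`. -/
theorem growPart_sampleState (t n k : ℕ) :
    M.growPart (M.sampleState t) t (n + 1) k = M.op t n true *
      (M.law t).mean fun G => open Classical in if G.order = n then
        ∑ S, M.attach t G S * (G.extend S).degreeFraction k else 0 := by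
  classical
  cases k with
  | zero =>
    rw [growPart, sampleState_mul_growStay, tsum_sampleState_mul_growNew, ← PMF.mean_add]
    congr 2
    funext G
    split_ifs with h
    · simp only [degreeFraction_extend, h, div_eq_mul_inv, ← mul_assoc, ← Finset.sum_mul]
      rw [← add_mul]
      congr 1
      simp only [mul_add, Finset.sum_add_distrib, Finset.mul_sum]
      rw [Finset.sum_comm]
      congr 1
      · refine Finset.sum_congr rfl fun v _ => ?_
        by_cases hv : G.deg v = 0
        · rw [if_pos hv]
          refine Finset.sum_congr rfl fun S _ => ?_
          by_cases hS : v ∈ S <;> simp [hS, hv]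
        · simp [hv]
      · simp
    · simp
  | succ k =>
    rw [growPart, sampleState_mul_growStay, sampleState_mul_growUp, tsum_sampleState_mul_growNew,
      ← PMF.mean_add, ← PMF.mean_add]
    congr 2
    funext G
    split_ifs with h
    · simp only [degreeFraction_extend, h, div_eq_mul_inv, ← mul_assoc, ← Finset.sum_mul]
      rw [← add_mul, ← add_mul]
      congr 1
      simp only [mul_add, Finset.sum_add_distrib, Finset.mul_sum]
      rw [Finset.sum_comm, ← Finset.sum_add_distrib]
      congr 1
      · refine Finset.sum_congr rfl fun v _ => ?_
        by_cases hv : G.deg v = k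
        · rw [if_neg (by lia), if_pos hv, zero_add]
          refine Finset.sum_congr rfl fun S _ => ?_
          by_cases hS : v ∈ S <;> simp [hS, hv]
        · rw [if_neg hv, add_zero]
          by_cases hv' : G.deg v = k + 1
          · rw [if_pos hv']
            refine Finset.sum_congr rfl fun S _ => ?_
            by_cases hS : v ∈ S <;> simp [hS, hv']
          · rw [if_neg hv', eq_comm]
            refine Finset.sum_eq_zero fun S _ => ?_
            rw [if_neg (by split_ifs <;> lia), mul_zero]
      · simp
    · simp

/-! ### Decay -/

-- Double counting of pairs of a deleted node `w` and a survivor: the survivor ends with degree `k`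
-- iff it had degree `k` and was not adjacent to `w`, or had `k + 1` and was.
open Classical in
theorem sum_decay {n : ℕ} (G : SimpleGraph (Fin (n + 2))) (q : Fin (n + 2) → ℝ≥0∞) (k : ℕ) :
    ((∑ v, if Net.deg ⟨n + 1, G⟩ v = k then ∑ w, if w ≠ v ∧ ¬ G.Adj v w then q w else 0 else 0) +
      ∑ v, if Net.deg ⟨n + 1, G⟩ v = k + 1 then ∑ w, if G.Adj v w then q w else 0 else 0) =
    ∑ w, q w * ∑ u, if Net.deg ⟨n, G.comap w.succAbove⟩ u = k then 1 else 0 := by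
  have hc (p : Prop) [Decidable p] (g : Fin (n + 2) → ℝ≥0∞) :
      (if p then ∑ w, g w else 0) = ∑ w, if p then g w else 0 := by
    split_ifs <;> simp
  simp only [hc]
  rw [← Finset.sum_add_distrib]
  simp only [← Finset.sum_add_distrib]
  rw [Finset.sum_comm]
  refine Finset.sum_congr rfl fun w _ => ?_
  rw [Fin.sum_univ_succAbove _ w, Finset.mul_sum]
  simp only [ne_eq, not_true_eq_false, false_and, if_false, ite_self, SimpleGraph.irrefl, zero_add]
  refine Finset.sum_congr rfl fun u _ => ?_
  rw [Net.deg_succAbove]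
  by_cases ha : G.Adj (w.succAbove u) w
  · simp [ha]
  · simp [ha, (Fin.succAbove_ne w u).symm]

/-- The left side is normalised by the old order `n + 1`, degree fractions of `G - w` by `n`. Both
factors are multiplied out so that `n = 0` needs no division. -/
theorem sampleState_mul_decay (t n k : ℕ) :
    ((n : ℝ≥0∞) + 1) * (M.sampleState t (n + 1) k * M.decayStay t (n + 1) k +
      M.sampleState t (n + 1) (k + 1) * M.decayDrop t (n + 1) (k + 1)) =
    n * (M.law t).mean fun G => open Classical in if G.order = n + 1 then
      ∑ w, M.remove t G w * (if G.1 = 0 then 0 else (G.erase w).degreeFraction k) else 0 := by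
  classical
  rw [decayStay, decayDrop, sampleState_mul_stateAvg, sampleState_mul_stateAvg, ← PMF.mean_add,
    ← PMF.mean_const_mul, ← PMF.mean_const_mul]
  congr 1
  funext ⟨m, G⟩
  by_cases h : Net.order ⟨m, G⟩ = n + 1
  · simp only [if_pos h]
    have hm : m = n := by simpa [Net.order] using h
    subst hm
    rw [← ENNReal.add_div]
    push_cast
    rw [ENNReal.mul_div_cancel (by simp) (by finiteness)]
    cases m with
    | zero =>
      have h0 (a b : Fin (0 + 1)) : a = b := Subsingleton.elim (α := Fin 1) a b
      simp [h0 _ 0]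
    | succ m =>
      refine (sum_decay G _ k).trans ?_
      simp only [Net.degreeFraction_eq, Nat.succ_ne_zero, if_false, Net.erase, Net.order]
      simp only [div_eq_mul_inv, ← mul_assoc, ← Finset.sum_mul]
      rw [← div_eq_mul_inv, mul_div_assoc, ENNReal.mul_div_cancel (by simp) (by simp)]
      rfl
  · simp only [if_neg h, add_zero, mul_zero]

theorem decay_sum_eq (t : ℕ) (x : NodeInNet) : open Classical in
    ((∑ w, if w ≠ x.2 ∧ ¬ x.1.2.Adj x.2 w then M.remove t x.1 w else 0) +
      ∑ w, if x.1.2.Adj x.2 w then M.remove t x.1 w else 0) + M.remove t x.1 x.2 = 1 := by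
  classical
  have h1 : M.remove t x.1 x.2 = ∑ w, if w = x.2 then M.remove t x.1 w else 0 := by simp
  rw [h1, ← Finset.sum_add_distrib, ← Finset.sum_add_distrib]
  refine Eq.trans (Finset.sum_congr rfl fun w _ => ?_)
    ((tsum_fintype _).symm.trans (M.remove t x.1).tsum_coe)
  by_cases hw : w = x.2
  · simp [hw]
  · by_cases ha : x.1.2.Adj x.2 w <;> simp [hw, ha]

theorem stateAvg_add (t n k : ℕ) (f g : NodeInNet → ℝ≥0∞) :
    M.stateAvg t n k f + M.stateAvg t n k g = M.stateAvg t n k fun x => f x + g x := by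
  classical
  simp only [stateAvg]
  rw [← ENNReal.add_div, ← ENNReal.tsum_add]
  congr 2
  funext x
  split_ifs
  · rw [mul_add]
  · rw [add_zero]

theorem stateAvg_one (t n k : ℕ) (h : M.sampleState t n k ≠ 0) :
    (M.stateAvg t n k fun _ => 1) = 1 := by
  classical
  simp only [stateAvg, mul_one]
  exact ENNReal.div_self h (M.sampleState_ne_top t n k)

theorem decay_add_qState (t n k : ℕ) (h : M.sampleState t n k ≠ 0) :
    (M.decayStay t n k + M.decayDrop t n k) + M.qState t n k = 1 := by
  classical
  rw [decayStay, decayDrop, qState, stateAvg_add, stateAvg_add]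
  simp only [decay_sum_eq]
  exact M.stateAvg_one t n k h

theorem one_sub_qState (t n k : ℕ) (h : M.sampleState t n k ≠ 0) :
    1 - M.qState t n k = M.decayStay t n k + M.decayDrop t n k := by
  have := M.decay_add_qState t n k h
  rw [← this]
  -- Truncated subtraction cancels because an infinite removal average would contradict the sum
  -- being `1`.
  exact ENNReal.add_sub_cancel_right fun hq => by simp [hq] at this

/-- Removal probabilities sum to `1` in each network, so a uniform node of `n + 1` is removed with
probability `1/(n+1)`. -/
theorem tsum_sampleState_mul_qState (t n : ℕ) :
    ∑' j, M.sampleState t (n + 1) j = (n + 1) * ∑' j, M.sampleState t (n + 1) j *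
      M.qState t (n + 1) j := by
  classical
  have h1 : ∑' j, M.sampleState t (n + 1) j =
      ∑' j, M.sampleState t (n + 1) j * M.stateAvg t (n + 1) j fun _ => 1 := by
    refine tsum_congr fun j => ?_
    by_cases h : M.sampleState t (n + 1) j = 0
    · simp [h]
    · rw [stateAvg_one _ _ _ _ h, mul_one]
  simp only [h1, qState]
  rw [tsum_sampleState_mul_stateAvg, tsum_sampleState_mul_stateAvg, ← PMF.mean_const_mul]
  congr 1
  funext G
  split_ifs with h
  · have h2 : ∑ v, M.remove t G v = 1 := (tsum_fintype _).symm.trans (M.remove t G).tsum_coe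
    rw [h2, Finset.sum_const, Finset.card_univ, Fintype.card_fin, nsmul_eq_mul,
      show G.1 + 1 = n + 1 from h, mul_one]
    push_cast
    rw [mul_one_div]
  · rw [mul_zero]

theorem tsum_sampleState_le_one (t n : ℕ) : ∑' j, M.sampleState t n j ≤ 1 := by
  classical
  simp only [sampleState_eq_mean]
  rw [← PMF.mean_tsum]
  refine (PMF.mean_mono _ (g := fun _ => 1) fun x => ?_).trans_eq (PMF.mean_const _ 1)
  rw [tsum_eq_single (x.state.2)]
  · split_ifs <;> simp
  · intro j hj
    rw [if_neg]
    intro h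
    exact hj (by rw [h])

/-- This evaluates the denominator in `decayIsolated`. -/
theorem tsum_sampleState_mul_one_sub_qState (t n : ℕ) :
    ∑' j, M.sampleState t (n + 1) j * (1 - M.qState t (n + 1) j) =
      n * ∑' j, M.sampleState t (n + 1) j * M.qState t (n + 1) j := by
  have hQ := M.tsum_sampleState_mul_qState t n
  have hle := M.tsum_sampleState_le_one t (n + 1)
  set Q := ∑' j, M.sampleState t (n + 1) j * M.qState t (n + 1) j with hQdef
  have hfin : Q ≠ ∞ := by
    rintro h
    rw [hQ, h, ENNReal.mul_top (by simp)] at hle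
    simp at hle
  rw [← ENNReal.add_left_inj hfin]
  rw [← add_one_mul, ← hQ, hQdef, ← ENNReal.tsum_add]
  refine tsum_congr fun j => ?_
  by_cases h : M.sampleState t (n + 1) j = 0
  · simp [h]
  · rw [← mul_add, one_sub_qState _ _ _ _ h, decay_add_qState _ _ _ _ h, mul_one]

theorem mul_div_add_eq_of_le_one {a b c : ℝ≥0∞} (h : c = a + b) (hc : c ≤ 1) :
    c * (a / (a + b)) = a ∧ c * (b / (a + b)) = b := by
  subst h
  by_cases h0 : a + b = 0
  · rw [add_eq_zero] at h0
    simp [h0]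
  · have ht := (hc.trans_lt ENNReal.one_lt_top).ne
    exact ⟨ENNReal.mul_div_cancel h0 ht, ENNReal.mul_div_cancel h0 ht⟩

/-- Since `1 - q = a + b` on states of positive probability, the conditional weights in
`decayIsolated` collapse to `a` and `b`. -/
theorem sampleState_mul_decay_ratio (t n k : ℕ) :
    (1 - M.qState t n k) * M.sampleState t n k *
        (M.decayStay t n k / (M.decayStay t n k + M.decayDrop t n k)) =
      M.sampleState t n k * M.decayStay t n k ∧
    (1 - M.qState t n k) * M.sampleState t n k *
        (M.decayDrop t n k / (M.decayStay t n k + M.decayDrop t n k)) =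
      M.sampleState t n k * M.decayDrop t n k := by
  by_cases h : M.sampleState t n k = 0
  · simp [h]
  · have h1 := mul_div_add_eq_of_le_one (M.one_sub_qState t n k h) tsub_le_self
    rw [mul_comm (1 - _), mul_assoc, mul_assoc, h1.1, h1.2]
    exact ⟨rfl, rfl⟩

/-- Only the factor `q` of `decayIsolated` depends on the starting degree `j`. The sum over `j`
yields `Q`, the denominator is `n * Q`, and so reinsertion contributes `1/n` of what the survivors
do. -/
theorem tsum_sampleState_mul_decayIsolated (t n k : ℕ) :
    n * ∑' j, M.sampleState t (n + 1) j *
        M.decayIsolated (M.sampleState t) t (n + 1) j k =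
      if n = 0 then 0 else M.sampleState t (n + 1) k * M.decayStay t (n + 1) k +
        M.sampleState t (n + 1) (k + 1) * M.decayDrop t (n + 1) (k + 1) := by
  split_ifs with hn
  · simp [hn]
  have hQ := M.tsum_sampleState_mul_qState t n
  have hle := M.tsum_sampleState_le_one t (n + 1)
  simp only [decayIsolated, tsum_sampleState_mul_one_sub_qState, ← mul_assoc]
  rw [ENNReal.tsum_mul_right]
  set Q := ∑' j, M.sampleState t (n + 1) j * M.qState t (n + 1) j with hQdef
  have hfin : Q ≠ ∞ := by
    rintro h
    rw [hQ, h, ENNReal.mul_top (by simp)] at hle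
    simp at hle
  have hn' : (n : ℝ≥0∞) ≠ 0 := by exact_mod_cast hn
  have hr (a b : ℝ≥0∞) : a / (n * Q) * b = (a * b) / (n * Q) := by
    rw [div_eq_mul_inv, mul_right_comm, div_eq_mul_inv]
  rw [hr, hr, (M.sampleState_mul_decay_ratio t (n + 1) k).1,
    (M.sampleState_mul_decay_ratio t (n + 1) (k + 1)).2, ← ENNReal.add_div]
  -- If `Q = 0`, no network with `n + 1` nodes has positive probability and every term vanishes.
  by_cases h0 : Q = 0
  · rw [h0, mul_zero, ENNReal.tsum_eq_zero] at hQ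
    simp [hQ]
  · rw [← mul_assoc]
    exact ENNReal.mul_div_cancel (mul_ne_zero hn' h0)
      (ENNReal.mul_ne_top (ENNReal.natCast_ne_top _) hfin)

theorem decayPart_sampleState (t n k : ℕ) :
    M.decayPart (M.sampleState t) t n k = M.op t (n + 1) false *
      (M.law t).mean fun G => open Classical in if G.order = n + 1 then
        ∑ w, M.remove t G w * (if G.1 = 0 then 0 else (G.erase w).degreeFraction k) else 0 := by
  rw [decayPart]
  cases n with
  | zero => simp [M.op_one]
  | succ n =>
    congr 1
    have h1 := M.sampleState_mul_decay t (n + 1) k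
    have h2 := M.tsum_sampleState_mul_decayIsolated t (n + 1) k
    rw [if_neg (Nat.succ_ne_zero n)] at h2
    have hn : ((n + 1 : ℕ) : ℝ≥0∞) ≠ 0 := by simp
    -- With `m = n + 1`, survivors' part `A`, reinserted part `B` and target `E`: `m B = A` and `(m
    -- + 1) A = m E`, so `m (A + B) = m E`.
    rw [← ENNReal.mul_right_inj hn (ENNReal.natCast_ne_top _), ← h1, mul_add, h2]
    ring

/-! ### The transition equation reproduces the evolving rule. -/

theorem esprState_step (t n k : ℕ) :
    M.growPart (M.sampleState t) t n k + M.decayPart (M.sampleState t) t n k =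
      M.ruleState (t + 1) n k := by
  classical
  rw [ruleState_eq_mean, law, PMF.mean_bind, decayPart_sampleState]
  simp only [ruleStep, PMF.mean_bind, PMF.mean_bool, if_true, Bool.false_eq_true, if_false,
    PMF.mean_map, PMF.mean_add, PMF.mean_fintype (M.attach t _), PMF.mean_fintype (M.remove t _)]
  congr 1
  · cases n with
    | zero => simp [growPart, Net.order_extend, PMF.mean]
    | succ n =>
      rw [growPart_sampleState, ← PMF.mean_const_mul]
      congr 1
      funext G
      simp only [Net.order_extend, Nat.add_right_cancel_iff]
      split_ifs with h
      · rw [h]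
      · simp
  · rw [← PMF.mean_const_mul]
    congr 1
    funext ⟨m, G⟩
    cases m with
    | zero =>
      cases n with
      | zero => simp [Net.order, M.op_one]
      | succ n => simp [Net.order, M.op_one]
    | succ m =>
      have ho (w : Fin (m + 2)) : (Net.erase ⟨m + 1, G⟩ w).order = m + 1 := rfl
      have ho' : Net.order ⟨m + 1, G⟩ = m + 1 + 1 := rfl
      simp only [Nat.succ_ne_zero, if_false, ho, ho', Nat.add_right_cancel_iff]
      by_cases h : m + 1 = n
      · subst h
        simp
      · simp [h]

/-- The coefficients are averages over the sample space, so the induction hypothesis must replace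
`EP` by `sampleState` before `esprState_step` applies. -/
theorem esprState_eq_ruleState (t : ℕ) : M.esprState t = M.ruleState t := by
  induction t with
  | zero =>
    funext n k
    exact M.sampleState_eq_ruleState 0 n k
  | succ t ih =>
    have h : M.ruleState t = M.sampleState t := by
      funext n k
      exact (M.sampleState_eq_ruleState t n k).symm
    funext n k
    rw [esprState, ih, h, esprState_step]

theorem ruleDegree_eq_esprDegree (t k : ℕ) : M.ruleDegree t k = M.esprDegree t k := by
  classical
  rw [esprDegree, esprState_eq_ruleState]
  simp only [ruleState_eq_mean]
  rw [← PMF.mean_tsum, ruleDegree, PMF.mean]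
  simp

end EvolvingModel

theorem theorem1 (M : EvolvingModel) :
    (∀ t n k, M.sampleState t n k = M.ruleState t n k ∧
      M.esprState t n k = M.ruleState t n k) ∧
    (∀ t k, M.ruleDegree t k = M.esprDegree t k) ∧
    (∀ p : ℕ → ℝ≥0∞, IsSteady M.ruleDegree p ↔ IsSteady M.esprDegree p) ∧
    (∀ P EP : ℕ → ℝ≥0∞, IsSteady M.ruleDegree P → IsSteady M.esprDegree EP →
      ∀ k, P k = EP k) := by
  have h : M.ruleDegree = M.esprDegree := by
    funext t k
    exact M.ruleDegree_eq_esprDegree t k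
  refine ⟨fun t n k => ⟨M.sampleState_eq_ruleState t n k, by rw [M.esprState_eq_ruleState]⟩,
    M.ruleDegree_eq_esprDegree, fun p => by rw [h], fun P EP hP hEP k => ?_⟩
  rw [← h] at hEP
  exact tendsto_nhds_unique (hP k) (hEP k)
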